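/- Fix a positive integer $n$ and let $[n]=\{1,\dots,n\}$. Let $\mathcal A$ be the set of symbols $a_{ij|K}=a_{ji|K}$ with $i,j\in[n]$ distinct and $K\subseteq[n]\setminus\{i,j\}$; let $p_I$, $I\subseteq [n]$, be further symbols. The edge trinomials are the polynomials $$p_{iL}\,a_{jk|L}-p_L\,a_{jk|iL}-a_{ij|L}\,a_{ik|L},\qquad p_{ijL}\,a_{jk|L}-p_{jL}\,a_{jk|iL}-a_{ij|L}\,a_{ik|jL},\qquad p_{ijkL}\,a_{jk|L}-p_{jkL}\,a_{jk|iL}-a_{ij|kL}\,a_{ik|jL}$$ for distinct $i,j,k\in[n]$ and $L\subseteq[n]\setminus\{i,j,k\}$, where $iL=\{i\}\cup L$ etc. A positive gaussoid on $[n]$ is a map $\varphi:\mathcal A\to\{0,1\}$ such that, for each edge trinomial, after setting every $p_I$ to $+1$ and every $a_{ij|K}$ to $\varphi(a_{ij|K})$, the set of values of its three terms is $\{0\}$, $\{-1,+1\}$ or $\{-1,0,+1\}$. It is identified with the set $\varphi^{-1}(0)\subseteq\mathcal A$. For a simple graph $\Gamma=([n],E)$, let $\mathcal G_\Gamma\subseteq\mathcal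 A$ be the set of all $a_{ij|K}$ such that every path from $i$ to $j$ in $\Gamma$ uses at least one vertex of $K$. For a real symmetric $n\times n$ matrix $\Sigma$, let $a_{ij|K}(\Sigma)$ be the minor of $\Sigma$ with rows $\{i\}\cup K$ and columns $\{j\}\cup K$, with $i$ and $j$ listed first and the elements of $K$ in the same order in rows and columns. A covariance matrix (that is, a positive definite real symmetric matrix) $\Sigma$ realizes a positive gaussoid $\varphi$ if the sign of $a_{ij|K}(\Sigma)$ equals $\varphi(a_{ij|K})$ for all $a_{ij|K}\in\mathcal A$. **Theorem.** There are exactly $2^{\binom n2}$ positive gaussoids on $[n]$: they are the $\mathcal G_\Gamma$, one for each of the graphs $\Gamma=([n],E)$ (that is, $\Gamma\mapsto\mathcal G_\Gamma$ is a bijection from the simple graphs on $[n]$ to the positive gaussoids on $[n]$). Every positive gaussoid is realized by a covariance matrix. For every $\Gamma$, the space of covariance matrices that realize the positive gaussoid $\mathcal G_\Gamma$ is homeomorphic to an open ball of dimension $|E|+n$. -/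

import Mathlib

/-- The symbols `a_{ij|K}`: an unordered pair of distinct elements `i, j` of `[n]`, together with
a set `K ⊆ [n] \ {i, j}`. -/
@[ext]
structure CISymbol (n : ℕ) where
  pair : Sym2 (Fin n)
  cond : Finset (Fin n)
  not_isDiag : ¬ pair.IsDiag
  notMem_cond : ∀ v ∈ pair, v ∉ cond

/-- The symbol `a_{ij|K}`. -/
def CISymbol.of {n : ℕ} (i j : Fin n) (K : Finset (Fin n))
    (hij : i ≠ j) (hi : i ∉ K) (hj : j ∉ K) : CISymbol n where
  pair := s(i, j)
  cond := K
  not_isDiag := by simpa using hij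
  notMem_cond := by
    intro v hv
    rcases Sym2.mem_iff.mp hv with rfl | rfl
    · exact hi
    · exact hj

/-- The unknowns `p_I` (principal minors) and `a_{ij|K}` (almost-principal minors). -/
inductive Unknown (n : ℕ) : Type
  | p (I : Finset (Fin n)) : Unknown n
  | a (x : CISymbol n) : Unknown n

/-- A signed product of two unknowns, i.e. a term of a quadratic polynomial with coefficient `±1`. -/
structure QuadTerm (n : ℕ) where
  coeff : SignType
  fst : Unknown n
  snd : Unknown n

/-- The edge trinomials `t₁ + t₂ + t₃`, given by their three terms. There is one for every edge
(in direction `i`) of every `3`-face (in directions `i, j, k`, with lowest vertex `L`) of the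
`n`-cube. The edge starts at `L`, at `L ∪ {j}` or at `L ∪ {j, k}`; edges starting at `L ∪ {k}`
arise from the second case by exchanging `j` and `k`. -/
inductive IsEdgeTrinomial {n : ℕ} : QuadTerm n → QuadTerm n → QuadTerm n → Prop
  /-- `p_{iL} a_{jk|L} - p_L a_{jk|iL} - a_{ij|L} a_{ik|L}` -/
  | lower (i j k : Fin n) (L : Finset (Fin n)) (hij : i ≠ j) (hik : i ≠ k) (hjk : j ≠ k)
      (hi : i ∉ L) (hj : j ∉ L) (hk : k ∉ L) :
      IsEdgeTrinomial
        ⟨1, .p (insert i L), .a (.of j k L hjk hj hk)⟩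
        ⟨-1, .p L, .a (.of j k (insert i L) hjk (by grind) (by grind))⟩
        ⟨-1, .a (.of i j L hij hi hj), .a (.of i k L hik hi hk)⟩
  /-- `p_{ijL} a_{jk|L} - p_{jL} a_{jk|iL} - a_{ij|L} a_{ik|jL}` -/
  | middle (i j k : Fin n) (L : Finset (Fin n)) (hij : i ≠ j) (hik : i ≠ k) (hjk : j ≠ k)
      (hi : i ∉ L) (hj : j ∉ L) (hk : k ∉ L) :
      IsEdgeTrinomial
        ⟨1, .p (insert i (insert j L)), .a (.of j k L hjk hj hk)⟩
        ⟨-1, .p (insert j L), .a (.of j k (insert i L) hjk (by grind) (by grind))⟩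
        ⟨-1, .a (.of i j L hij hi hj), .a (.of i k (insert j L) hik (by grind) (by grind))⟩
  /-- `p_{ijkL} a_{jk|L} - p_{jkL} a_{jk|iL} - a_{ij|kL} a_{ik|jL}` -/
  | upper (i j k : Fin n) (L : Finset (Fin n)) (hij : i ≠ j) (hik : i ≠ k) (hjk : j ≠ k)
      (hi : i ∉ L) (hj : j ∉ L) (hk : k ∉ L) :
      IsEdgeTrinomial
        ⟨1, .p (insert i (insert j (insert k L))), .a (.of j k L hjk hj hk)⟩
        ⟨-1, .p (insert j (insert k L)), .a (.of j k (insert i L) hjk (by grind) (by grind))⟩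
        ⟨-1, .a (.of i j (insert k L) hij (by grind) (by grind)),
          .a (.of i k (insert j L) hik (by grind) (by grind))⟩

/-- The value of an unknown after setting every `p_I` to `+1` and every `a_{ij|K}` to its image
under `φ`. -/
def Unknown.signValue {n : ℕ} (φ : CISymbol n → SignType) : Unknown n → SignType
  | .p _ => 1
  | .a x => φ x

/-- The value of a term after setting every `p_I` to `+1` and every `a_{ij|K}` to its image
under `φ`. -/
def QuadTerm.signValue {n : ℕ} (φ : CISymbol n → SignType) (t : QuadTerm n) : SignType :=
  t.coeff * (t.fst.signValue φ * t.snd.signValue φ)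

/-- Oriented gaussoids on `[n]`: sign maps for which the set of values of the terms of every edge
trinomial is `{0}`, `{-1, +1}` or `{-1, 0, +1}`. -/
def IsOrientedGaussoid {n : ℕ} (φ : CISymbol n → SignType) : Prop :=
  ∀ t₁ t₂ t₃ : QuadTerm n, IsEdgeTrinomial t₁ t₂ t₃ →
    ({t₁.signValue φ, t₂.signValue φ, t₃.signValue φ} : Finset SignType) ∈
      ({{0}, {-1, 1}, {-1, 0, 1}} : Set (Finset SignType))

/-- Positive gaussoids on `[n]`: oriented gaussoids with values in `{0, 1}`. -/
def IsPositiveGaussoid {n : ℕ} (φ : CISymbol n → SignType) : Prop :=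
  IsOrientedGaussoid φ ∧ ∀ x, φ x = 0 ∨ φ x = 1

/-- The separation gaussoid of a graph `Γ`: all `a_{ij|K}` such that every path from `i` to `j`
in `Γ` uses at least one vertex in `K`. -/
def separationGaussoid {n : ℕ} (Γ : SimpleGraph (Fin n)) : Set (CISymbol n) :=
  {x | ∀ i j : Fin n, x.pair = s(i, j) →
    ∀ w : Γ.Walk i j, w.IsPath → ∃ v ∈ w.support, v ∈ x.cond}

open Classical in
/-- The map `𝒜 → {0, 1}` that is `0` exactly on `G`. -/
noncomputable def positiveSigns {n : ℕ} (G : Set (CISymbol n)) : CISymbol n → SignType :=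
  fun x => if x ∈ G then 0 else 1

/-- The almost-principal minor `a_{ij|K}` of `M`, with rows `i, K` and columns `j, K`, where `i`
and `j` come first and the elements of `K` are listed in the same order in rows and columns. -/
def almostPrincipalMinor {n : ℕ} (M : Matrix (Fin n) (Fin n) ℝ) (i j : Fin n)
    (K : Finset (Fin n)) : ℝ :=
  (M.submatrix (Sum.elim (fun _ : Unit => i) (fun k : {k // k ∈ K} => (k : Fin n)))
    (Sum.elim (fun _ : Unit => j) (fun k : {k // k ∈ K} => (k : Fin n)))).det

/-- The space of covariance matrices, i.e. positive definite real symmetric matrices, whose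
almost-principal minors have the signs prescribed by `φ`. -/
def realizationSpace {n : ℕ} (φ : CISymbol n → SignType) : Set (Matrix (Fin n) (Fin n) ℝ) :=
  {M | M.PosDef ∧ ∀ (i j : Fin n) (K : Finset (Fin n)) (hij : i ≠ j) (hi : i ∉ K) (hj : j ∉ K),
    SignType.sign (almostPrincipalMinor M i j K) = φ (.of i j K hij hi hj)}

/-! For a `{0, 1}`-valued map an edge trinomial says: `a_{jk|L} = 1` iff `a_{jk|iL} = 1` or both
factors of the last term are `1`. The upper trinomials thus compute the value at `L` from values at
sets with one more element, so everything is determined by the top symbols, `K = [n] \ {i, j}`,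
which form an arbitrary graph `Γ`. Connectivity in `Γ` minus `K` obeys the same recursion
(`insert_or`, `eq_ite_connectedAvoiding_of_recursion`). This gives the bijection.

On positive definite matrices the upper trinomials vanish with positive principal minors as
coefficients (`exists_edge_relation`), so nonnegative minors propagate their signs by the same
recursion, and again only the top minors matter. These are negative multiples of the off-diagonal
entries of the inverse. Hence inversion maps the realization space onto the positive definite `Q`
that are negative on edges and zero on non-edges (`mem_realizationSpace_iff`). This is an open
convex cone in `|E| + n` coordinates; it contains the identity plus the Laplacian of `Γ`, and its
part of trace below `1` is bounded, so it is a ball. -/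

/-! ### Connectivity in a graph with vertices deleted. -/

/-- There is a walk from `i` to `j` avoiding `K`. -/
def SimpleGraph.ConnectedAvoiding {n : ℕ} (Γ : SimpleGraph (Fin n)) (K : Finset (Fin n))
    (i j : Fin n) : Prop :=
  ∃ w : Γ.Walk i j, ∀ v ∈ w.support, v ∉ K

namespace SimpleGraph.ConnectedAvoiding

variable {n : ℕ} {Γ : SimpleGraph (Fin n)} {K L : Finset (Fin n)} {i j k : Fin n}

theorem symm (h : Γ.ConnectedAvoiding K i j) : Γ.ConnectedAvoiding K j i := by
  obtain ⟨w, hw⟩ := h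
  exact ⟨w.reverse, by simpa using hw⟩

theorem trans (h : Γ.ConnectedAvoiding K i j) (h' : Γ.ConnectedAvoiding K j k) :
    Γ.ConnectedAvoiding K i k := by
  obtain ⟨w, hw⟩ := h
  obtain ⟨w', hw'⟩ := h'
  refine ⟨w.append w', fun v hv => ?_⟩
  rcases (Walk.mem_support_append_iff _ _).1 hv with hv | hv
  · exact hw v hv
  · exact hw' v hv

theorem mono (hLK : L ⊆ K) (h : Γ.ConnectedAvoiding K i j) : Γ.ConnectedAvoiding L i j := by
  obtain ⟨w, hw⟩ := h
  exact ⟨w, fun v hv hvL => hw v hv (hLK hvL)⟩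

theorem exists_isPath (h : Γ.ConnectedAvoiding K i j) :
    ∃ w : Γ.Walk i j, w.IsPath ∧ ∀ v ∈ w.support, v ∉ K := by
  obtain ⟨w, hw⟩ := h
  classical
  exact ⟨w.bypass, w.bypass_isPath, fun v hv => hw v (w.support_bypass_subset_support hv)⟩

/-- A path from `j` to `k` either avoids `i` or splits into a path from `i` to `j` avoiding `k` and
a path from `i` to `k` avoiding `j`. -/
theorem insert_or (hij : i ≠ j) (hik : i ≠ k) (h : Γ.ConnectedAvoiding L j k) :
    Γ.ConnectedAvoiding (insert i L) j k ∨
      (Γ.ConnectedAvoiding (insert k L) i j ∧ Γ.ConnectedAvoiding (insert j L) i k) := by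
  obtain ⟨w, hp, hw⟩ := h.exists_isPath
  by_cases hi : i ∈ w.support
  · right
    refine ⟨ConnectedAvoiding.symm ⟨w.takeUntil i hi, fun v hv => ?_⟩,
      ⟨w.dropUntil i hi, fun v hv => ?_⟩⟩
    · rw [Finset.mem_insert, not_or]
      refine ⟨?_, hw v (w.support_takeUntil_subset_support hi hv)⟩
      rintro rfl
      exact Walk.endpoint_notMem_support_takeUntil hp hi hik.symm hv
    · rw [Finset.mem_insert, not_or]
      refine ⟨?_, hw v (w.support_dropUntil_subset_support hi hv)⟩
      rintro rfl
      have h1 := hp.support_nodup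
      -- Here `v = j` starts the first half; meeting it again after `i` would repeat a vertex of the
      -- path.
      rw [← w.take_spec hi, Walk.support_append, List.nodup_append] at h1
      have h2 : v ∈ (w.dropUntil i hi).support.tail := by
        rw [← Walk.cons_tail_support, List.mem_cons] at hv
        exact hv.resolve_left hij.symm
      exact h1.2.2 v (Walk.start_mem_support _) v h2 rfl
  · left
    refine ⟨w, fun v hv => ?_⟩
    rw [Finset.mem_insert, not_or]
    exact ⟨fun h => hi (h ▸ hv), hw v hv⟩

end SimpleGraph.ConnectedAvoiding

/-! ### Positive gaussoids are separation gaussoids of graphs. -/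

section Gaussoids

variable {n : ℕ}

/-- Only `i` and `j` survive the deletion, so the first step of the walk is already the edge. Top
symbols therefore record the edges of `Γ`. -/
theorem SimpleGraph.connectedAvoiding_compl_pair_iff (Γ : SimpleGraph (Fin n)) {i j : Fin n}
    (hij : i ≠ j) : Γ.ConnectedAvoiding ({i, j} : Finset (Fin n))ᶜ i j ↔ Γ.Adj i j := by
  constructor
  · rintro ⟨w, hw⟩
    cases w with
    | nil => exact absurd rfl hij
    | @cons _ v _ h p =>
      have hv := hw v (by simp)
      simp only [Finset.mem_compl, Finset.mem_insert, Finset.mem_singleton, not_not] at hv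
      rcases hv with rfl | rfl
      · exact absurd h (Γ.loopless.irrefl _)
      · exact h
  · intro h
    exact ⟨h.toWalk, by simp [SimpleGraph.Adj.toWalk]⟩

theorem CISymbol.exists_eq_of (x : CISymbol n) :
    ∃ i j K hij hi hj, x = CISymbol.of i j K hij hi hj := by
  obtain ⟨p, K, h1, h2⟩ := x
  induction p with
  | h i j => exact ⟨i, j, K, by simpa using h1, h2 i (by simp), h2 j (by simp), rfl⟩

theorem CISymbol.of_comm (i j : Fin n) (K : Finset (Fin n)) (hij : i ≠ j) (hi : i ∉ K)
    (hj : j ∉ K) : CISymbol.of i j K hij hi hj = CISymbol.of j i K hij.symm hj hi := by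
  ext1
  · exact Sym2.eq_swap
  · rfl

theorem of_mem_separationGaussoid_iff (Γ : SimpleGraph (Fin n)) {i j : Fin n}
    {K : Finset (Fin n)} (hij : i ≠ j) (hi : i ∉ K) (hj : j ∉ K) :
    CISymbol.of i j K hij hi hj ∈ separationGaussoid Γ ↔ ¬ Γ.ConnectedAvoiding K i j := by
  constructor
  · intro h hc
    obtain ⟨w, hp, hw⟩ := hc.exists_isPath
    obtain ⟨v, hv, hvK⟩ := h i j rfl w hp
    exact hw v hv hvK
  · intro h i' j' hp w _
    by_contra! hw
    rcases Sym2.eq_iff.1 hp with ⟨rfl, rfl⟩ | ⟨rfl, rfl⟩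
    · exact h ⟨w, hw⟩
    · exact h (SimpleGraph.ConnectedAvoiding.symm ⟨w, hw⟩)

open Classical in
theorem positiveSigns_separationGaussoid_of (Γ : SimpleGraph (Fin n)) {i j : Fin n}
    {K : Finset (Fin n)} (hij : i ≠ j) (hi : i ∉ K) (hj : j ∉ K) :
    positiveSigns (separationGaussoid Γ) (CISymbol.of i j K hij hi hj) =
      if Γ.ConnectedAvoiding K i j then 1 else 0 := by
  simp only [positiveSigns, of_mem_separationGaussoid_iff]
  split_ifs <;> rfl

theorem positiveSigns_eq_zero_or_one (G : Set (CISymbol n)) (x : CISymbol n) :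
    positiveSigns G x = 0 ∨ positiveSigns G x = 1 := by
  unfold positiveSigns
  split_ifs <;> simp

/-- The first term lies in `{0, 1}`, the other two in `{0, -1}`; the allowed sets are those where
the positive term is nonzero exactly when some negative term is. -/
theorem edge_term_signs_iff {a b c d : SignType} (ha : a = 0 ∨ a = 1) (hb : b = 0 ∨ b = 1)
    (hc : c = 0 ∨ c = 1) (hd : d = 0 ∨ d = 1) :
    (({1 * (1 * a), -1 * (1 * b), -1 * (c * d)} : Finset SignType) ∈
      ({{0}, {-1, 1}, {-1, 0, 1}} : Set (Finset SignType))) ↔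
      (a = 1 ↔ b = 1 ∨ (c = 1 ∧ d = 1)) := by
  simp only [Set.mem_insert_iff, Set.mem_singleton_iff]
  rcases ha with rfl | rfl <;> rcases hb with rfl | rfl <;> rcases hc with rfl | rfl <;>
    rcases hd with rfl | rfl <;> decide

/-- `insert_or` is the forward implication for the upper trinomial; the lower and middle ones follow
by shrinking the avoided sets. Backwards, walks are concatenated at `i`. -/
theorem isPositiveGaussoid_separationGaussoid (Γ : SimpleGraph (Fin n)) :
    IsPositiveGaussoid (positiveSigns (separationGaussoid Γ)) := by
  refine ⟨?_, positiveSigns_eq_zero_or_one _⟩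
  have h01 := positiveSigns_eq_zero_or_one (separationGaussoid Γ)
  have hone : ∀ {p : Prop} [Decidable p], (if p then (1 : SignType) else 0) = 1 ↔ p := by
    intro p _
    split_ifs <;> simp_all
  intro t₁ t₂ t₃ h
  cases h with
  | lower i j k L hij hik hjk hi hj hk =>
    refine (edge_term_signs_iff (h01 _) (h01 _) (h01 _) (h01 _)).2 ?_
    simp only [positiveSigns_separationGaussoid_of, hone]
    refine ⟨fun h => (h.insert_or hij hik).imp_right fun h' =>
      ⟨h'.1.mono (Finset.subset_insert _ _), h'.2.mono (Finset.subset_insert _ _)⟩, ?_⟩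
    rintro (h | ⟨h, h'⟩)
    · exact h.mono (Finset.subset_insert _ _)
    · exact h.symm.trans h'
  | middle i j k L hij hik hjk hi hj hk =>
    refine (edge_term_signs_iff (h01 _) (h01 _) (h01 _) (h01 _)).2 ?_
    simp only [positiveSigns_separationGaussoid_of, hone]
    refine ⟨fun h => (h.insert_or hij hik).imp_right fun h' =>
      ⟨h'.1.mono (Finset.subset_insert _ _), h'.2⟩, ?_⟩
    rintro (h | ⟨h, h'⟩)
    · exact h.mono (Finset.subset_insert _ _)
    · exact h.symm.trans (h'.mono (Finset.subset_insert _ _))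
  | upper i j k L hij hik hjk hi hj hk =>
    refine (edge_term_signs_iff (h01 _) (h01 _) (h01 _) (h01 _)).2 ?_
    simp only [positiveSigns_separationGaussoid_of, hone]
    refine ⟨fun h => h.insert_or hij hik, ?_⟩
    rintro (h | ⟨h, h'⟩)
    · exact h.mono (Finset.subset_insert _ _)
    · exact (h.symm.mono (Finset.subset_insert _ _)).trans (h'.mono (Finset.subset_insert _ _))

open Classical in
/-- A `{0, 1}`-valued family that satisfies the recursion of the upper edge trinomials is the
connectivity function of the graph that it has at the top level. -/
theorem eq_ite_connectedAvoiding_of_recursion (Γ : SimpleGraph (Fin n))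
    (f : Fin n → Fin n → Finset (Fin n) → SignType)
    (htop : ∀ i j, i ≠ j → f i j {i, j}ᶜ = if Γ.Adj i j then 1 else 0)
    (hrec : ∀ (i j k : Fin n) (L : Finset (Fin n)), i ≠ j → i ≠ k → j ≠ k → i ∉ L → j ∉ L → k ∉ L →
      (f j k (insert i L) = 0 ∨ f j k (insert i L) = 1) →
      (f i j (insert k L) = 0 ∨ f i j (insert k L) = 1) →
      (f i k (insert j L) = 0 ∨ f i k (insert j L) = 1) →
      (f j k L = 0 ∨ f j k L = 1) ∧ (f j k L = 1 ↔ f j k (insert i L) = 1 ∨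
        (f i j (insert k L) = 1 ∧ f i k (insert j L) = 1)))
    (i j : Fin n) (K : Finset (Fin n)) (hij : i ≠ j) (hi : i ∉ K) (hj : j ∉ K) :
    f i j K = if Γ.ConnectedAvoiding K i j then 1 else 0 := by
  -- The induction runs from large `K` to small `K`.
  have hcard : ∀ (K : Finset (Fin n)) (i : Fin n), i ∉ K → (insert i K)ᶜ.card < Kᶜ.card := by
    intro K i hi
    exact Finset.card_lt_card (compl_lt_compl_iff_lt.2 (Finset.ssubset_insert hi))
  induction hm : Kᶜ.card using Nat.strong_induction_on generalizing i j K with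
  | _ m ih =>
  subst hm
  by_cases htopK : K = {i, j}ᶜ
  · subst htopK
    rw [htop i j hij]
    simp only [Γ.connectedAvoiding_compl_pair_iff hij]
  · obtain ⟨l, hlK, hli, hlj⟩ : ∃ l, l ∉ K ∧ l ≠ i ∧ l ≠ j := by
      by_contra! h
      apply htopK
      ext l
      simp only [Finset.mem_compl, Finset.mem_insert, Finset.mem_singleton, not_or]
      refine ⟨fun hl => ⟨?_, ?_⟩, fun hl => ?_⟩
      · rintro rfl; exact hi hl
      · rintro rfl; exact hj hl
      · by_contra hlK
        exact hl.2 (h l hlK hl.1)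
    have h1 := ih _ (hcard K l hlK) i j (insert l K) hij (by grind) (by grind) rfl
    have h2 := ih _ (hcard K j hj) l i (insert j K) hli (by grind) (by grind) rfl
    have h3 := ih _ (hcard K i hi) l j (insert i K) hlj (by grind) (by grind) rfl
    have h01 : ∀ p : Prop, (if p then (1 : SignType) else 0) = 0 ∨
        (if p then (1 : SignType) else 0) = 1 := by
      intro p; split_ifs <;> simp
    -- `hrec` may assume its three inputs are `0` or `1`: signs of real minors obey the recursion
    -- only once negative inputs are excluded.
    obtain ⟨h4, h5⟩ := hrec l i j K hli hlj hij hlK hi hj (h1 ▸ h01 _) (h2 ▸ h01 _) (h3 ▸ h01 _)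
    have hone : ∀ {p : Prop}, (if p then (1 : SignType) else 0) = 1 ↔ p := by
      intro p
      split_ifs <;> simp_all
    rw [h1, h2, h3, hone, hone, hone] at h5
    split_ifs with hc
    · exact h5.2 (hc.insert_or hli hlj)
    · refine h4.resolve_right fun h => hc ?_
      rcases h5.1 h with h | ⟨h, h'⟩
      · exact h.mono (Finset.subset_insert _ _)
      · exact (h.symm.mono (Finset.subset_insert _ _)).trans (h'.mono (Finset.subset_insert _ _))

theorem IsPositiveGaussoid.exists_eq_positiveSigns {φ : CISymbol n → SignType}
    (h : IsPositiveGaussoid φ) : ∃ Γ, positiveSigns (separationGaussoid Γ) = φ := by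
  classical
  -- The default `0` on non-symbols is never consulted.
  let f : Fin n → Fin n → Finset (Fin n) → SignType := fun i j K =>
    if h : i ≠ j ∧ i ∉ K ∧ j ∉ K then φ (.of i j K h.1 h.2.1 h.2.2) else 0
  have hf : ∀ i j K (hij : i ≠ j) (hi : i ∉ K) (hj : j ∉ K),
      f i j K = φ (.of i j K hij hi hj) := fun i j K hij hi hj => dif_pos ⟨hij, hi, hj⟩
  -- The graph is read off from the top symbols.
  let Γ : SimpleGraph (Fin n) :=
    { Adj := fun i j => i ≠ j ∧ f i j {i, j}ᶜ = 1
      symm := ⟨by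
        rintro i j ⟨hij, h1⟩
        refine ⟨hij.symm, ?_⟩
        rw [hf _ _ _ hij (by simp) (by simp), CISymbol.of_comm] at h1
        rw [Finset.pair_comm, hf _ _ _ hij.symm (by simp) (by simp), h1]⟩
      loopless := ⟨fun i hi => hi.1 rfl⟩ }
  have key := eq_ite_connectedAvoiding_of_recursion Γ f
    (fun i j hij => by
      have h1 : Γ.Adj i j ↔ f i j {i, j}ᶜ = 1 := and_iff_right hij
      have h2 := h.2 (.of i j {i, j}ᶜ hij (by simp) (by simp))
      rw [← hf] at h2
      split_ifs with hadj
      · exact h1.1 hadj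
      · exact h2.resolve_right fun h' => hadj (h1.2 h'))
    (fun i j k L hij hik hjk hi hj hk _ _ _ => by
      rw [hf j k L hjk hj hk, hf j k _ hjk (by grind) (by grind),
        hf i j _ hij (by grind) (by grind), hf i k _ hik (by grind) (by grind)]
      exact ⟨h.2 _, (edge_term_signs_iff (h.2 _) (h.2 _) (h.2 _) (h.2 _)).1
        (h.1 _ _ _ (.upper i j k L hij hik hjk hi hj hk))⟩)
  refine ⟨Γ, funext fun x => ?_⟩
  obtain ⟨i, j, K, hij, hi, hj, rfl⟩ := x.exists_eq_of
  rw [positiveSigns_separationGaussoid_of, ← hf i j K hij hi hj, key i j K hij hi hj]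

theorem positiveSigns_separationGaussoid_injective :
    Function.Injective fun Γ : SimpleGraph (Fin n) => positiveSigns (separationGaussoid Γ) := by
  intro Γ Γ' h
  ext i j
  by_cases hij : i = j
  · subst hij
    simp
  · have h1 := congrFun h (.of i j {i, j}ᶜ hij (by simp) (by simp))
    simp only [positiveSigns_separationGaussoid_of] at h1
    rw [← Γ.connectedAvoiding_compl_pair_iff hij, ← Γ'.connectedAvoiding_compl_pair_iff hij]
    split_ifs at h1 with h2 h3 h3
    · exact iff_of_true h2 h3
    · exact iff_of_false h2 h3

theorem bijOn_positiveSigns_separationGaussoid :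
    Set.BijOn (fun Γ : SimpleGraph (Fin n) => positiveSigns (separationGaussoid Γ)) Set.univ
      {φ | IsPositiveGaussoid φ} := by
  refine ⟨fun Γ _ => isPositiveGaussoid_separationGaussoid Γ,
    positiveSigns_separationGaussoid_injective.injOn, fun φ hφ => ?_⟩
  obtain ⟨Γ, rfl⟩ := IsPositiveGaussoid.exists_eq_positiveSigns hφ
  exact ⟨Γ, trivial, rfl⟩

theorem SimpleGraph.card_fin : Nat.card (SimpleGraph (Fin n)) = 2 ^ n.choose 2 := by
  let e : SimpleGraph (Fin n) ≃ Set {x : Sym2 (Fin n) // ¬ x.IsDiag} :=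
    { toFun := fun Γ => {x | x.1 ∈ Γ.edgeSet}
      invFun := fun s => SimpleGraph.fromEdgeSet (Subtype.val '' s)
      left_inv := fun Γ => by
        ext i j
        simp only [SimpleGraph.fromEdgeSet_adj]
        constructor
        · rintro ⟨⟨x, hx, hx'⟩, -⟩
          rw [Set.mem_ofPred_eq, hx'] at hx
          exact hx
        · intro h
          exact ⟨⟨⟨s(i, j), by simpa using h.ne⟩, h, rfl⟩, h.ne⟩
      right_inv := fun s => by
        ext x
        simp only [SimpleGraph.edgeSet_fromEdgeSet, Set.mem_ofPred_eq, Set.mem_sdiff]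
        constructor
        · rintro ⟨⟨y, hy, hxy⟩, -⟩
          rwa [← Subtype.ext hxy]
        · exact fun hx => ⟨⟨x, hx, rfl⟩, x.2⟩ }
  rw [Nat.card_congr e, Nat.card_eq_fintype_card, Fintype.card_set,
    Sym2.card_subtype_not_diag, Fintype.card_fin]

end Gaussoids

/-! ### Minors of positive definite matrices via Schur complements. -/

/-- The inclusion of a finset of indices. -/
abbrev incl {n : ℕ} (K : Finset (Fin n)) : {k // k ∈ K} → Fin n := Subtype.val

/-- The Schur complement of the principal block `K`, with rows and columns indexed by `[n]`. -/
noncomputable def schurCompl {n : ℕ} (M : Matrix (Fin n) (Fin n) ℝ) (K : Finset (Fin n)) :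
    Matrix (Fin n) (Fin n) ℝ :=
  M - M.submatrix id (incl K) *
    (M.submatrix (incl K) (incl K))⁻¹ *
    M.submatrix (incl K) id

/-- The minor of `M` with rows `f, K` and columns `g, K`. -/
noncomputable def borderedMinor {n : ℕ} {T : Type*} [Fintype T] [DecidableEq T]
    (M : Matrix (Fin n) (Fin n) ℝ) (K : Finset (Fin n)) (f g : T → Fin n) : ℝ :=
  (M.submatrix (Sum.elim f (incl K)) (Sum.elim g (incl K))).det

section Minors

variable {n : ℕ} {M : Matrix (Fin n) (Fin n) ℝ} {K L : Finset (Fin n)} {i j k : Fin n}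

theorem Matrix.PosDef.isUnit_det_submatrix_val (hM : M.PosDef) (K : Finset (Fin n)) :
    IsUnit (M.submatrix (incl K) (incl K)).det :=
  (hM.submatrix Subtype.val_injective).det_pos.ne'.isUnit

/-- Schur's determinant formula; it reduces relations among minors containing `K` to identities
between small determinants of the Schur complement. -/
theorem borderedMinor_eq_det_mul_det_schurCompl (hM : M.PosDef) {T : Type*} [Fintype T]
    [DecidableEq T] (f g : T → Fin n) :
    borderedMinor M K f g =
      (M.submatrix (incl K) (incl K)).det *
        ((schurCompl M K).submatrix f g).det := by
  let _ := Matrix.invertibleOfIsUnitDet _ (hM.isUnit_det_submatrix_val K)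
  have h : M.submatrix (Sum.elim f (incl K))
      (Sum.elim g (incl K)) = Matrix.fromBlocks (M.submatrix f g) (M.submatrix f (incl K))
        (M.submatrix (incl K) g) (M.submatrix (incl K) (incl K)) := by
    ext (a | a) (b | b) <;> rfl
  rw [borderedMinor, h, Matrix.det_fromBlocks₂₂, Matrix.invOf_eq_nonsing_inv]
  rfl

theorem borderedMinor_self_pos (hM : M.PosDef) {T : Type*} [Fintype T] [DecidableEq T]
    {f : T → Fin n} (hf : Function.Injective f) (hfK : ∀ t, f t ∉ K) :
    0 < borderedMinor M K f f := by
  refine (hM.submatrix (Function.Injective.sumElim hf Subtype.val_injective ?_)).det_pos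
  intro t x h
  exact hfK t (h ▸ x.2)

theorem almostPrincipalMinor_eq_borderedMinor (M : Matrix (Fin n) (Fin n) ℝ) (i j : Fin n)
    (K : Finset (Fin n)) :
    almostPrincipalMinor M i j K = borderedMinor M K (fun _ : Unit => i) (fun _ => j) := rfl

/-- Adjoining an element to a finset, on the level of index types of bordered minors. -/
noncomputable def borderEquiv (K : Finset (Fin n)) (hk : k ∉ K) :
    Fin 2 ⊕ {x // x ∈ K} ≃ Unit ⊕ {x // x ∈ insert k K} :=
  Equiv.ofBijective
    (Sum.elim ![Sum.inl (), Sum.inr ⟨k, Finset.mem_insert_self k K⟩]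
      fun x => Sum.inr ⟨x, Finset.mem_insert_of_mem x.2⟩) (by
    constructor
    · rintro (a | a) (b | b) h
      · fin_cases a <;> fin_cases b <;> simp_all
      · fin_cases a
        · simp at h
        · simp only [Sum.elim_inl, Sum.elim_inr] at h
          exact absurd (Subtype.ext_iff.1 (Sum.inr_injective h)) fun h' => hk (by
            have h' : k = b := h'
            exact h' ▸ b.2)
      · fin_cases b
        · simp at h
        · simp only [Sum.elim_inl, Sum.elim_inr] at h
          exact absurd (Subtype.ext_iff.1 (Sum.inr_injective h)) fun h' => hk (by
            have h' : (a : Fin n) = k := h'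
            exact h' ▸ a.2)
      · simp only [Sum.elim_inr, Sum.inr.injEq, Subtype.mk.injEq] at h
        rw [Subtype.ext h]
    · rintro (a | ⟨a, ha⟩)
      · exact ⟨Sum.inl 0, rfl⟩
      · rcases Finset.mem_insert.1 ha with rfl | ha'
        · exact ⟨Sum.inl 1, rfl⟩
        · exact ⟨Sum.inr ⟨a, ha'⟩, rfl⟩)

theorem almostPrincipalMinor_insert (M : Matrix (Fin n) (Fin n) ℝ) (i j : Fin n) (hk : k ∉ K) :
    almostPrincipalMinor M i j (insert k K) = borderedMinor M K ![i, k] ![j, k] := by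
  rw [almostPrincipalMinor, ← Matrix.det_submatrix_equiv_self (borderEquiv K hk),
    Matrix.submatrix_submatrix, borderedMinor]
  congr 1
  have h : ∀ l : Fin n, Sum.elim (fun _ : Unit => l)
      (fun x : {x // x ∈ insert k K} => (x : Fin n)) ∘ borderEquiv K hk =
      Sum.elim ![l, k] Subtype.val := by
    intro l
    ext (a | a)
    · fin_cases a <;> rfl
    · rfl
  rw [h, h]

theorem schurCompl_apply_comm (hM : M.PosDef) (K : Finset (Fin n)) (i j : Fin n) :
    schurCompl M K i j = schurCompl M K j i := by
  have hs : M.transpose = M := by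
    have := hM.isHermitian
    rwa [Matrix.IsHermitian, Matrix.conjTranspose_eq_transpose_of_trivial] at this
  have : (schurCompl M K).transpose = schurCompl M K := by
    simp only [schurCompl, Matrix.transpose_sub, Matrix.transpose_mul, Matrix.transpose_submatrix,
      Matrix.transpose_nonsing_inv, hs, Matrix.mul_assoc]
  exact congrFun (congrFun this.symm i) j

/-- The upper edge trinomials vanish on positive definite matrices. -/
theorem exists_edge_relation (hM : M.PosDef) (hij : i ≠ j) (hik : i ≠ k) (hjk : j ≠ k)
    (hi : i ∉ L) (hj : j ∉ L) (hk : k ∉ L) :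
    ∃ p q : ℝ, 0 < p ∧ 0 < q ∧ p * almostPrincipalMinor M j k L =
      q * almostPrincipalMinor M j k (insert i L) +
        almostPrincipalMinor M i j (insert k L) * almostPrincipalMinor M i k (insert j L) := by
  -- The coefficients are the principal minors `p_{ijkL}` and `p_{jkL}`.
  refine ⟨borderedMinor M L ![i, j, k] ![i, j, k], borderedMinor M L ![j, k] ![j, k],
    borderedMinor_self_pos hM ?_ ?_, borderedMinor_self_pos hM ?_ ?_, ?_⟩
  · intro a b h
    fin_cases a <;> fin_cases b <;> simp_all [eq_comm]
  · intro a
    fin_cases a <;> assumption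
  · intro a b h
    fin_cases a <;> fin_cases b <;> simp_all [eq_comm]
  · intro a
    fin_cases a <;> assumption
  · rw [almostPrincipalMinor_insert _ _ _ hi, almostPrincipalMinor_insert _ _ _ hj,
      almostPrincipalMinor_insert _ _ _ hk, almostPrincipalMinor_eq_borderedMinor]
    -- Every product acquires the square of the determinant of the block `L`; what remains is an
    -- identity for a symmetric `3 × 3` matrix.
    simp only [borderedMinor_eq_det_mul_det_schurCompl hM, Matrix.det_fin_two, Matrix.det_fin_three,
      Matrix.submatrix_apply, Matrix.det_unique]
    simp only [Matrix.cons_val_zero, Matrix.cons_val_one, Matrix.cons_val]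
    rw [schurCompl_apply_comm hM L j i, schurCompl_apply_comm hM L k i,
      schurCompl_apply_comm hM L k j]
    ring

theorem schurCompl_apply_of_mem (hM : M.PosDef) (i : Fin n) (hk : k ∈ K) :
    schurCompl M K i k = 0 := by
  have h : schurCompl M K i k = (M.submatrix id (incl K) -
      M.submatrix id (incl K) *
      (M.submatrix (incl K) (incl K))⁻¹ *
      M.submatrix (incl K) (incl K)) i ⟨k, hk⟩ := rfl
  rw [h, Matrix.nonsing_inv_mul_cancel_right _ _ (hM.isUnit_det_submatrix_val K), sub_self]
  rfl

/-- The rows of `M` indexed by `K` times `M⁻¹` are rows of the identity, so the correction term only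
reaches columns in `K`. -/
theorem schurCompl_mul_inv_apply (hM : M.PosDef) (hij : i ≠ j) (hj : j ∉ K) :
    (schurCompl M K * M⁻¹) i j = 0 := by
  have hu : IsUnit M.det := hM.det_pos.ne'.isUnit
  have h1 : M.submatrix (incl K) id * M⁻¹ =
      (1 : Matrix (Fin n) (Fin n) ℝ).submatrix (incl K) id := by
    rw [← Matrix.mul_nonsing_inv M hu]
    rfl
  rw [schurCompl, Matrix.sub_mul, Matrix.mul_assoc, h1, Matrix.mul_nonsing_inv M hu,
    Matrix.sub_apply, Matrix.one_apply_ne hij, Matrix.mul_apply, zero_sub, neg_eq_zero]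
  refine Finset.sum_eq_zero fun x _ => ?_
  have hx : incl K x ≠ j := fun h => hj (h ▸ x.2)
  rw [Matrix.submatrix_apply, id, Matrix.one_apply_ne hx, mul_zero]

/-- Up to a negative factor, the almost-principal minors of maximal size are the off-diagonal
entries of the inverse. -/
theorem exists_almostPrincipalMinor_compl_pair (hM : M.PosDef) (hij : i ≠ j) :
    ∃ c : ℝ, 0 < c ∧ almostPrincipalMinor M i j {i, j}ᶜ = -c * M⁻¹ i j := by
  set K : Finset (Fin n) := {i, j}ᶜ with hK
  have hi : i ∉ K := by simp [hK]
  have hj : j ∉ K := by simp [hK]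
  have hq : 0 < M⁻¹ j j := hM.inv.diag_pos
  have hp : 0 < borderedMinor M K (fun _ : Unit => i) (fun _ => i) :=
    borderedMinor_self_pos hM (Function.injective_of_subsingleton _) fun _ => hi
  have h0 := schurCompl_mul_inv_apply hM hij hj
  -- The Schur complement `S` vanishes in the columns of `K`, leaving `S_ii (M⁻¹)_ij + S_ij (M⁻¹)_jj
  -- = 0`; solving for `S_ij` gives the constant below.
  rw [Matrix.mul_apply, ← Finset.sum_subset (Finset.subset_univ {i, j}) (fun x _ hx => by
    rw [schurCompl_apply_of_mem hM i (by simpa [hK] using hx), zero_mul]),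
    Finset.sum_pair hij] at h0
  refine ⟨borderedMinor M K (fun _ : Unit => i) (fun _ => i) / M⁻¹ j j, div_pos hp hq, ?_⟩
  rw [almostPrincipalMinor_eq_borderedMinor]
  simp only [borderedMinor_eq_det_mul_det_schurCompl hM, Matrix.det_unique, Matrix.submatrix_apply]
  field_simp
  linear_combination
    (M.submatrix (incl K) (incl K)).det * h0

end Minors

/-! ### Realizing matrices in terms of their inverses. -/

section RealizationSpaces

variable {n : ℕ}

/-- Positive definite matrices whose off-diagonal entries are negative on the edges of `Γ` and zero
elsewhere. -/
def graphMMatrices (Γ : SimpleGraph (Fin n)) : Set (Matrix (Fin n) (Fin n) ℝ) :=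
  {Q | Q.PosDef ∧ ∀ i j, i ≠ j → (Γ.Adj i j → Q i j < 0) ∧ (¬ Γ.Adj i j → Q i j = 0)}

theorem sign_almostPrincipalMinor_compl_pair {M : Matrix (Fin n) (Fin n) ℝ} (hM : M.PosDef)
    {i j : Fin n} (hij : i ≠ j) :
    SignType.sign (almostPrincipalMinor M i j {i, j}ᶜ) = -SignType.sign (M⁻¹ i j) := by
  obtain ⟨c, hc, h⟩ := exists_almostPrincipalMinor_compl_pair hM hij
  rw [h, neg_mul, Left.sign_neg, sign_mul, sign_pos hc, one_mul]

/-- The top minors give one direction. Conversely, they are nonnegative with the right zeros, and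
the edge relation carries this down without cancellation, both terms on its right-hand side being
nonnegative. -/
theorem mem_realizationSpace_iff (Γ : SimpleGraph (Fin n)) {M : Matrix (Fin n) (Fin n) ℝ} :
    M ∈ realizationSpace (positiveSigns (separationGaussoid Γ)) ↔ M⁻¹ ∈ graphMMatrices Γ := by
  classical
  constructor
  · rintro ⟨hM, h⟩
    refine ⟨hM.inv, fun i j hij => ?_⟩
    have h1 := h i j {i, j}ᶜ hij (by simp) (by simp)
    rw [sign_almostPrincipalMinor_compl_pair hM hij, positiveSigns_separationGaussoid_of] at h1
    simp only [SimpleGraph.connectedAvoiding_compl_pair_iff _ hij] at h1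
    refine ⟨fun ha => ?_, fun ha => ?_⟩
    · rw [if_pos ha] at h1
      exact sign_eq_neg_one_iff.1 (neg_eq_iff_eq_neg.1 h1)
    · rw [if_neg ha] at h1
      exact sign_eq_zero_iff.1 (neg_eq_iff_eq_neg.1 h1)
  · rintro ⟨hM', h⟩
    have hM : M.PosDef := Matrix.posDef_inv_iff.1 hM'
    refine ⟨hM, fun i j K hij hi hj => ?_⟩
    rw [positiveSigns_separationGaussoid_of]
    refine eq_ite_connectedAvoiding_of_recursion Γ
      (fun i j K => SignType.sign (almostPrincipalMinor M i j K)) (fun i j hij => ?_)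
      (fun i j k L hij hik hjk hi hj hk hb hc hd => ?_) i j K hij hi hj
    · rw [sign_almostPrincipalMinor_compl_pair hM hij]
      split_ifs with ha
      · rw [sign_neg ((h i j hij).1 ha)]
        rfl
      · rw [(h i j hij).2 ha, sign_zero]
        rfl
    · obtain ⟨p, q, hp, hq, hrel⟩ := exists_edge_relation hM hij hik hjk hi hj hk
      generalize almostPrincipalMinor M j k L = a at *
      generalize almostPrincipalMinor M j k (insert i L) = b at *
      generalize almostPrincipalMinor M i j (insert k L) = c at *
      generalize almostPrincipalMinor M i k (insert j L) = d at *
      simp only [sign_eq_zero_iff, sign_eq_one_iff] at hb hc hd ⊢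
      have hb' : 0 ≤ b := hb.elim (fun h => h.ge) le_of_lt
      have hc' : 0 ≤ c := hc.elim (fun h => h.ge) le_of_lt
      have hd' : 0 ≤ d := hd.elim (fun h => h.ge) le_of_lt
      have ha' : 0 ≤ a := nonneg_of_mul_nonneg_right (by rw [hrel]; positivity) hp
      refine ⟨ha'.eq_or_lt.imp_left Eq.symm, fun ha => ?_, ?_⟩
      · by_contra! hcon
        have hb0 : b = 0 := le_antisymm hcon.1 hb'
        have hcd : c * d = 0 := by
          rcases hc with hc | hc
          · rw [hc, zero_mul]
          · rw [le_antisymm (hcon.2 hc) hd', mul_zero]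
        rw [hb0, hcd, mul_zero, add_zero] at hrel
        exact (mul_pos hp ha).ne' hrel
      · have key : 0 < p * a → 0 < a := fun h => pos_of_mul_pos_right h hp.le
        rintro (hb | ⟨hc, hd⟩)
        · exact key (by rw [hrel]; positivity)
        · exact key (by rw [hrel]; positivity)

end RealizationSpaces

/-! ### Open convex cones and balls. -/

/-- A nonempty open bounded convex set is homeomorphic to the open unit ball. -/
theorem nonempty_homeomorph_ball_of_isBounded {E : Type*} [NormedAddCommGroup E] [NormedSpace ℝ E]
    {s : Set E} (hc : Convex ℝ s) (ho : IsOpen s) (hne : s.Nonempty)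
    (hb : Bornology.IsBounded s) : Nonempty (s ≃ₜ Metric.ball (0 : E) 1) := by
  obtain ⟨h, h1, -⟩ := exists_homeomorph_image_interior_closure_frontier_eq_unitBall hc
    (by rwa [ho.interior_eq]) hb
  rw [ho.interior_eq] at h1
  exact ⟨(h.image s).trans (Homeomorph.setCongr h1)⟩

/-- A nonempty open convex cone on which a linear functional is positive is homeomorphic to the unit
ball if the part below level `1` is bounded. -/
theorem nonempty_homeomorph_ball_of_cone {E : Type*} [NormedAddCommGroup E] [NormedSpace ℝ E]
    {s : Set E} (hc : Convex ℝ s) (ho : IsOpen s) (hne : s.Nonempty)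
    (hcone : ∀ c : ℝ, 0 < c → ∀ x ∈ s, c • x ∈ s) (τ : E →L[ℝ] ℝ) (hτ : ∀ x ∈ s, 0 < τ x)
    (hb : Bornology.IsBounded (s ∩ {x | τ x < 1})) : Nonempty (s ≃ₜ Metric.ball (0 : E) 1) := by
  have hlow : ∀ x ∈ s, (1 + τ x)⁻¹ • x ∈ s ∩ {x | τ x < 1} := by
    intro x hx
    have h0 := hτ x hx
    refine ⟨hcone _ (by positivity) x hx, ?_⟩
    change τ ((1 + τ x)⁻¹ • x) < 1
    rw [map_smul, smul_eq_mul, inv_mul_lt_iff₀ (by positivity)]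
    linarith
  obtain ⟨e⟩ := nonempty_homeomorph_ball_of_isBounded
    (hc.inter (convex_halfSpace_lt τ.toLinearMap.isLinear 1))
    (ho.inter (isOpen_lt τ.continuous continuous_const)) ⟨_, hlow _ hne.some_mem⟩ hb
  -- Along each ray `τ` is rescaled by `t ↦ t / (1 + t)`, from `(0, ∞)` onto `(0, 1)`, with inverse
  -- `t ↦ t / (1 - t)`.
  have e' : s ≃ₜ (s ∩ {x | τ x < 1} : Set E) :=
    { toFun := fun x => ⟨(1 + τ x)⁻¹ • (x : E), hlow x x.2⟩
      invFun := fun x => ⟨(1 - τ x)⁻¹ • (x : E),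
        hcone _ (inv_pos.2 (sub_pos.2 x.2.2)) x x.2.1⟩
      left_inv := fun x => by
        have h0 := hτ x x.2
        apply Subtype.ext
        simp only [map_smul, smul_eq_mul, smul_smul]
        have h1 : (1 - (1 + τ x)⁻¹ * τ x)⁻¹ * (1 + τ x)⁻¹ = 1 := by
          have h2 : 1 - (1 + τ x)⁻¹ * τ x = (1 + τ x)⁻¹ := by
            field_simp
            ring
          rw [h2, inv_inv, mul_inv_cancel₀ (by positivity)]
        rw [h1, one_smul]
      right_inv := fun x => by
        have h0 : 0 < 1 - τ x := sub_pos.2 x.2.2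
        apply Subtype.ext
        simp only [map_smul, smul_eq_mul, smul_smul]
        have h1 : (1 + (1 - τ x)⁻¹ * τ x)⁻¹ * (1 - τ x)⁻¹ = 1 := by
          have h2 : 1 + (1 - τ x)⁻¹ * τ x = (1 - τ x)⁻¹ := by
            field_simp
            ring
          rw [h2, inv_inv, mul_inv_cancel₀ h0.ne']
        rw [h1, one_smul]
      continuous_toFun := by
        refine Continuous.subtype_mk (Continuous.smul (Continuous.inv₀ (by fun_prop) ?_)
          continuous_subtype_val) _
        intro x
        have h0 := hτ x x.2
        positivity
      continuous_invFun := by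
        refine Continuous.subtype_mk (Continuous.smul (Continuous.inv₀ (by fun_prop) ?_)
          continuous_subtype_val) _
        intro x
        exact (sub_pos.2 x.2.2).ne' }
  exact ⟨e'.trans e⟩

theorem Matrix.continuousOn_inv_isUnit_det {m : Type*} [Fintype m] [DecidableEq m] :
    ContinuousOn (fun M : Matrix m m ℝ => M⁻¹) {M | M.det ≠ 0} := by
  simp only [Matrix.inv_def, Ring.inverse_eq_inv']
  refine ContinuousOn.smul (ContinuousOn.inv₀ (Continuous.continuousOn ?_) fun M hM => hM)
    (Continuous.continuousOn ?_)
  · exact continuous_id.matrix_det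
  · exact continuous_id.matrix_adjugate

/-! ### The cone of concentration matrices. -/

section ConcentrationMatrices

variable {n : ℕ}

/-- Matrix inversion identifies the realization space with the space of concentration matrices. -/
noncomputable def realizationSpaceHomeomorph (Γ : SimpleGraph (Fin n)) :
    realizationSpace (positiveSigns (separationGaussoid Γ)) ≃ₜ graphMMatrices Γ where
  toFun M := ⟨(M : Matrix (Fin n) (Fin n) ℝ)⁻¹, (mem_realizationSpace_iff Γ).1 M.2⟩
  invFun Q := ⟨(Q : Matrix (Fin n) (Fin n) ℝ)⁻¹, (mem_realizationSpace_iff Γ).2 (by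
    rw [Matrix.nonsing_inv_nonsing_inv _ Q.2.1.det_pos.ne'.isUnit]
    exact Q.2)⟩
  left_inv M := Subtype.ext (Matrix.nonsing_inv_nonsing_inv _ M.2.1.det_pos.ne'.isUnit)
  right_inv Q := Subtype.ext (Matrix.nonsing_inv_nonsing_inv _ Q.2.1.det_pos.ne'.isUnit)
  continuous_toFun := by
    refine Continuous.subtype_mk ?_ _
    exact Matrix.continuousOn_inv_isUnit_det.comp_continuous continuous_subtype_val
      fun M => M.2.1.det_pos.ne'
  continuous_invFun := by
    refine Continuous.subtype_mk ?_ _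
    exact Matrix.continuousOn_inv_isUnit_det.comp_continuous continuous_subtype_val
      fun M => M.2.1.det_pos.ne'

theorem graphMMatrices_nonempty (Γ : SimpleGraph (Fin n)) : (graphMMatrices Γ).Nonempty := by
  classical
  -- The Laplacian is positive semidefinite with `-1` on edges and `0` on non-edges; the identity
  -- makes it definite.
  refine ⟨1 + Γ.lapMatrix ℝ, Matrix.PosDef.one.add_posSemidef (Γ.posSemidef_lapMatrix ℝ),
    fun i j hij => ⟨fun h => ?_, fun h => ?_⟩⟩ <;>
  simp [SimpleGraph.lapMatrix, SimpleGraph.degMatrix, hij, h]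

/-- Positive `2 × 2` principal minors give `M_ij² < M_ii M_jj` off the diagonal. So bounding the
trace bounds the matrix. -/
theorem Matrix.PosDef.abs_apply_le_trace {m : Type*} [Fintype m] [DecidableEq m]
    {M : Matrix m m ℝ} (hM : M.PosDef) (i j : m) : |M i j| ≤ M.trace := by
  have hd : ∀ k, 0 < M k k := fun k => hM.diag_pos
  have hk : ∀ k, M k k ≤ M.trace := fun k =>
    Finset.single_le_sum (f := fun k => M k k) (fun k _ => (hd k).le) (Finset.mem_univ k)
  by_cases hij : i = j
  · subst hij
    rw [abs_of_pos (hd i)]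
    exact hk i
  have hsymm : M j i = M i j := by
    have := hM.isHermitian.apply i j
    simpa using this
  have h := (hM.submatrix (e := ![i, j]) (by
    intro a b h
    fin_cases a <;> fin_cases b <;> simp_all [eq_comm])).det_pos
  rw [Matrix.det_fin_two] at h
  simp only [Matrix.submatrix_apply, Matrix.cons_val_zero, Matrix.cons_val_one, hsymm] at h
  refine abs_le_of_sq_le_sq (by nlinarith [hk i, hk j, hd i, hd j]) ((hd i).le.trans (hk i))

theorem Matrix.posDef_iff_isSymm_and_pos {m : Type*} [Fintype m] {M : Matrix m m ℝ} :
    M.PosDef ↔ M.IsSymm ∧ ∀ x : m → ℝ, x ≠ 0 → 0 < x ⬝ᵥ M.mulVec x := by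
  rw [Matrix.posDef_iff_dotProduct_mulVec]
  simp [Matrix.IsHermitian, Matrix.IsSymm, Matrix.conjTranspose_eq_transpose_of_trivial]

/-- Positive definiteness is an open condition on continuous families of symmetric matrices. -/
theorem Matrix.isOpen_setOf_posDef {X m : Type*} [TopologicalSpace X] [Fintype m]
    {Q : X → Matrix m m ℝ} (hQ : Continuous Q) (hs : ∀ x, (Q x).IsSymm) :
    IsOpen {x | (Q x).PosDef} := by
  -- By homogeneity it suffices to test unit vectors; compactness of the sphere then gives one
  -- neighbourhood of `x` that works for all of them.
  have h : {x | (Q x).PosDef} =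
      {x | ∀ v ∈ Metric.sphere (0 : m → ℝ) 1, 0 < v ⬝ᵥ (Q x).mulVec v} := by
    ext x
    simp only [Set.mem_ofPred_eq, Matrix.posDef_iff_isSymm_and_pos, hs x, true_and]
    constructor
    · intro h v hv
      exact h v (ne_zero_of_mem_unit_sphere ⟨v, hv⟩)
    · intro h v hv
      have hv' : 0 < ‖v‖ := norm_pos_iff.2 hv
      have h1 := h (‖v‖⁻¹ • v) (by simp [norm_smul, hv'.ne'])
      rw [Matrix.mulVec_smul, smul_dotProduct, dotProduct_smul, smul_smul, smul_eq_mul] at h1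
      exact pos_of_mul_pos_right h1 (by positivity)
  rw [h, isOpen_iff_mem_nhds]
  intro x hx
  refine (isCompact_sphere (0 : m → ℝ) 1).eventually_forall_of_forall_eventually fun v hv => ?_
  have hcont : Continuous fun z : X × (m → ℝ) => z.2 ⬝ᵥ (Q z.1).mulVec z.2 :=
    continuous_snd.dotProduct ((hQ.comp continuous_fst).matrix_mulVec continuous_snd)
  exact hcont.continuousAt.eventually (lt_mem_nhds (hx v hv))

/-! ### Coordinates indexed by the edges and the diagonal. -/

section Parametrization

variable (Γ : SimpleGraph (Fin n)) {ι : Type*} [Fintype ι] (e : Γ.edgeSet ⊕ Fin n ≃ ι)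

open Classical in
/-- The symmetric matrix supported on `Γ` with prescribed entries on the edges and the diagonal. -/
noncomputable def graphMatrix : EuclideanSpace ℝ ι →L[ℝ] Matrix (Fin n) (Fin n) ℝ :=
  LinearMap.toContinuousLinearMap
    { toFun := fun x => Matrix.of fun i j =>
        if i = j then x (e (.inr i)) else
          if h : Γ.Adj i j then x (e (.inl ⟨s(i, j), h⟩)) else 0
      map_add' := fun x y => by
        ext i j
        simp only [Matrix.of_apply, Matrix.add_apply]
        split_ifs <;> simp
      map_smul' := fun c x => by
        ext i j
        simp only [Matrix.of_apply, Matrix.smul_apply]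
        split_ifs <;> simp }

variable {Γ}

theorem graphMatrix_apply_self (x : EuclideanSpace ℝ ι) (i : Fin n) :
    graphMatrix Γ e x i i = x (e (.inr i)) := by
  change (if i = i then _ else _) = _
  rw [if_pos rfl]

open Classical in
theorem graphMatrix_apply_of_adj (x : EuclideanSpace ℝ ι) {i j : Fin n} (h : Γ.Adj i j) :
    graphMatrix Γ e x i j = x (e (.inl ⟨s(i, j), h⟩)) := by
  change (if i = j then _ else if h : Γ.Adj i j then x (e (.inl ⟨s(i, j), h⟩)) else 0) = _
  rw [if_neg h.ne, dif_pos h]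

open Classical in
theorem graphMatrix_apply_of_not_adj (x : EuclideanSpace ℝ ι) {i j : Fin n} (hij : i ≠ j)
    (h : ¬ Γ.Adj i j) : graphMatrix Γ e x i j = 0 := by
  change (if i = j then _ else if h : Γ.Adj i j then x (e (.inl ⟨s(i, j), h⟩)) else 0) = _
  rw [if_neg hij, dif_neg h]

theorem graphMatrix_isSymm (x : EuclideanSpace ℝ ι) : (graphMatrix Γ e x).IsSymm := by
  ext i j
  rw [Matrix.transpose_apply]
  by_cases hij : i = j
  · rw [hij]
  by_cases h : Γ.Adj i j
  · rw [graphMatrix_apply_of_adj e x h, graphMatrix_apply_of_adj e x h.symm]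
    simp only [Sym2.eq_swap]
  · rw [graphMatrix_apply_of_not_adj e x hij h,
      graphMatrix_apply_of_not_adj e x (Ne.symm hij) fun h' => h h'.symm]

/-- The coordinates of a matrix with respect to `graphMatrix`. -/
noncomputable def graphCoords (Q : Matrix (Fin n) (Fin n) ℝ) : EuclideanSpace ℝ ι :=
  WithLp.toLp 2 fun t => Sum.elim (fun d : Γ.edgeSet => Q (Quot.out d.1).1 (Quot.out d.1).2)
    (fun i => Q i i) (e.symm t)

theorem graphCoords_graphMatrix (x : EuclideanSpace ℝ ι) :
    graphCoords e (graphMatrix Γ e x) = x := by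
  ext t
  obtain ⟨d | i, rfl⟩ := e.surjective t
  · have hd : s((Quot.out d.1).1, (Quot.out d.1).2) = d.1 := Quot.out_eq d.1
    have hadj : Γ.Adj (Quot.out d.1).1 (Quot.out d.1).2 := by
      rw [← SimpleGraph.mem_edgeSet, hd]
      exact d.2
    simp only [graphCoords, Equiv.symm_apply_apply, Sum.elim_inl]
    rw [graphMatrix_apply_of_adj e x hadj]
    simp only [hd]
  · simp only [graphCoords, Equiv.symm_apply_apply, Sum.elim_inr]
    exact graphMatrix_apply_self e x i

theorem graphMatrix_graphCoords {Q : Matrix (Fin n) (Fin n) ℝ} (hs : Q.IsSymm)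
    (h0 : ∀ i j, i ≠ j → ¬ Γ.Adj i j → Q i j = 0) :
    graphMatrix Γ e (graphCoords e Q) = Q := by
  ext i j
  by_cases hij : i = j
  · subst hij
    rw [graphMatrix_apply_self]
    simp [graphCoords]
  by_cases h : Γ.Adj i j
  · rw [graphMatrix_apply_of_adj e _ h]
    simp only [graphCoords, Equiv.symm_apply_apply, Sum.elim_inl]
    -- The chosen representative may be `(i, j)` or `(j, i)`; symmetry of `Q` makes the choice
    -- harmless.
    have hd : s((Quot.out s(i, j)).1, (Quot.out s(i, j)).2) = s(i, j) := Quot.out_eq s(i, j)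
    rcases Sym2.eq_iff.1 hd with ⟨h1, h2⟩ | ⟨h1, h2⟩
    · rw [h1, h2]
    · rw [h1, h2, hs.apply]
  · rw [graphMatrix_apply_of_not_adj e _ hij h, h0 i j hij h]

omit [Fintype ι] in
theorem continuous_graphCoords :
    Continuous (graphCoords e : Matrix (Fin n) (Fin n) ℝ → EuclideanSpace ℝ ι) := by
  refine (PiLp.continuous_toLp 2 _).comp (continuous_pi fun t => ?_)
  rcases e.symm t with d | i
  · exact continuous_id.matrix_elem _ _
  · exact continuous_id.matrix_elem _ _

theorem graphMatrix_graphCoords_of_mem {Q : Matrix (Fin n) (Fin n) ℝ}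
    (hQ : Q ∈ graphMMatrices Γ) : graphMatrix Γ e (graphCoords e Q) = Q :=
  graphMatrix_graphCoords e (Matrix.posDef_iff_isSymm_and_pos.1 hQ.1).1
    fun i j hij => (hQ.2 i j hij).2

/-- The coordinate description of `graphMMatrices Γ`. -/
noncomputable def graphMMatricesHomeomorph :
    graphMMatrices Γ ≃ₜ (graphMatrix Γ e ⁻¹' graphMMatrices Γ : Set (EuclideanSpace ℝ ι)) where
  toFun Q := ⟨graphCoords e Q,
    Set.mem_preimage.2 ((graphMatrix_graphCoords_of_mem e Q.2).symm ▸ Q.2)⟩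
  invFun x := ⟨graphMatrix Γ e x, x.2⟩
  left_inv Q := Subtype.ext (graphMatrix_graphCoords_of_mem e Q.2)
  right_inv x := Subtype.ext (graphCoords_graphMatrix e x)
  continuous_toFun := ((continuous_graphCoords e).comp continuous_subtype_val).subtype_mk _
  continuous_invFun := ((graphMatrix Γ e).continuous.comp continuous_subtype_val).subtype_mk _

/-- The coordinates build in symmetry and the zeros on non-edges, so only open conditions remain. -/
theorem isOpen_preimage_graphMMatrices : IsOpen (graphMatrix Γ e ⁻¹' graphMMatrices Γ) := by
  have h : graphMatrix Γ e ⁻¹' graphMMatrices Γ = {x | (graphMatrix Γ e x).PosDef} ∩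
      ⋂ i, ⋂ j, ⋂ (_ : Γ.Adj i j), {x | graphMatrix Γ e x i j < 0} := by
    ext x
    simp only [Set.mem_preimage, graphMMatrices, Set.mem_ofPred_eq, Set.mem_inter_iff,
      Set.mem_iInter]
    exact and_congr_right fun _ => ⟨fun h i j hij => (h i j hij.ne).1 hij, fun h i j hij =>
      ⟨h i j, graphMatrix_apply_of_not_adj e x hij⟩⟩
  rw [h]
  refine (Matrix.isOpen_setOf_posDef (graphMatrix Γ e).continuous (graphMatrix_isSymm e)).inter
    (isOpen_iInter_of_finite fun i => isOpen_iInter_of_finite fun j =>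
      isOpen_iInter_of_finite fun _ => ?_)
  exact isOpen_lt ((graphMatrix Γ e).continuous.matrix_elem i j) continuous_const

theorem smul_mem_graphMMatrices {c : ℝ} (hc : 0 < c) {Q : Matrix (Fin n) (Fin n) ℝ}
    (hQ : Q ∈ graphMMatrices Γ) : c • Q ∈ graphMMatrices Γ := by
  refine ⟨hQ.1.smul hc, fun i j hij => ⟨fun h => ?_, fun h => ?_⟩⟩
  · exact mul_neg_of_pos_of_neg hc ((hQ.2 i j hij).1 h)
  · rw [Matrix.smul_apply, (hQ.2 i j hij).2 h, smul_zero]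

theorem add_mem_graphMMatrices {P Q : Matrix (Fin n) (Fin n) ℝ} (hP : P ∈ graphMMatrices Γ)
    (hQ : Q ∈ graphMMatrices Γ) : P + Q ∈ graphMMatrices Γ := by
  refine ⟨hP.1.add hQ.1, fun i j hij => ⟨fun h => ?_, fun h => ?_⟩⟩
  · exact add_neg ((hP.2 i j hij).1 h) ((hQ.2 i j hij).1 h)
  · rw [Matrix.add_apply, (hP.2 i j hij).2 h, (hQ.2 i j hij).2 h, add_zero]

theorem convex_graphMMatrices : Convex ℝ (graphMMatrices Γ) :=
  convex_iff_forall_pos.2 fun _ hP _ hQ _ _ ha hb _ =>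
    add_mem_graphMMatrices (smul_mem_graphMMatrices ha hP) (smul_mem_graphMMatrices hb hQ)

theorem isBounded_preimage_graphMMatrices :
    Bornology.IsBounded (graphMatrix Γ e ⁻¹' graphMMatrices Γ ∩
      {x | (graphMatrix Γ e x).trace < 1}) := by
  -- Each coordinate is a matrix entry, so the bound is in the sup norm and is transferred to the
  -- Euclidean norm.
  have hb : Bornology.IsBounded (WithLp.ofLp ⁻¹' Metric.closedBall (0 : ι → ℝ) 1 :
      Set (EuclideanSpace ℝ ι)) :=
    (PiLp.antilipschitzWith_ofLp 2 fun _ : ι => ℝ).isBounded_preimage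
      Metric.isBounded_closedBall
  refine hb.subset ?_
  rintro x ⟨hx, hx1⟩
  rw [Set.mem_preimage, mem_closedBall_zero_iff, pi_norm_le_iff_of_nonneg zero_le_one]
  have hle : ∀ i j, |graphMatrix Γ e x i j| ≤ 1 := fun i j =>
    (hx.1.abs_apply_le_trace i j).trans (le_of_lt hx1)
  intro t
  rw [← graphCoords_graphMatrix e x, Real.norm_eq_abs]
  unfold graphCoords
  dsimp only
  rcases e.symm t with d | i
  · exact hle _ _
  · exact hle _ _

theorem nonempty_graphMMatrices_homeomorph_ball
    (e : Γ.edgeSet ⊕ Fin n ≃ ι) (hn : 0 < n) :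
    Nonempty (graphMMatrices Γ ≃ₜ Metric.ball (0 : EuclideanSpace ℝ ι) 1) := by
  let τ : EuclideanSpace ℝ ι →L[ℝ] ℝ :=
    ((Matrix.traceLinearMap (Fin n) ℝ ℝ).toContinuousLinearMap).comp (graphMatrix Γ e)
  have : NeZero n := ⟨hn.ne'⟩
  have hne : (graphMatrix Γ e ⁻¹' graphMMatrices Γ).Nonempty := by
    obtain ⟨Q, hQ⟩ := graphMMatrices_nonempty Γ
    exact ⟨_, ((graphMMatricesHomeomorph e) ⟨Q, hQ⟩).2⟩
  have hcone : ∀ c : ℝ, 0 < c → ∀ x ∈ graphMatrix Γ e ⁻¹' graphMMatrices Γ,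
      c • x ∈ graphMatrix Γ e ⁻¹' graphMMatrices Γ := by
    intro c hc x hx
    rw [Set.mem_preimage, map_smul]
    exact smul_mem_graphMMatrices hc hx
  -- The diagonal entry at `0` needs `0 < n`; for `n = 0` the trace would vanish.
  have hτ : ∀ x ∈ graphMatrix Γ e ⁻¹' graphMMatrices Γ, 0 < τ x := fun x hx =>
    (abs_pos.2 hx.1.diag_pos.ne').trans_le (hx.1.abs_apply_le_trace 0 0)
  obtain ⟨h⟩ := nonempty_homeomorph_ball_of_cone
    (convex_graphMMatrices.linear_preimage (graphMatrix Γ e).toLinearMap)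
    (isOpen_preimage_graphMMatrices e) hne hcone τ hτ (isBounded_preimage_graphMMatrices e)
  exact ⟨(graphMMatricesHomeomorph e).trans h⟩

end Parametrization

end ConcentrationMatrices

theorem mainTheorem2 (n : ℕ) (hn : 0 < n) :
    {φ : CISymbol n → SignType | IsPositiveGaussoid φ}.ncard = 2 ^ n.choose 2 ∧
    Set.BijOn (fun Γ : SimpleGraph (Fin n) => positiveSigns (separationGaussoid Γ)) Set.univ
      {φ | IsPositiveGaussoid φ} ∧
    (∀ φ : CISymbol n → SignType, IsPositiveGaussoid φ → (realizationSpace φ).Nonempty) ∧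
    ∀ Γ : SimpleGraph (Fin n),
      Nonempty (realizationSpace (positiveSigns (separationGaussoid Γ)) ≃ₜ
        Metric.ball (0 : EuclideanSpace ℝ (Fin (Γ.edgeSet.ncard + n))) 1) := by
  refine ⟨?_, bijOn_positiveSigns_separationGaussoid, ?_, ?_⟩
  · rw [← SimpleGraph.card_fin, ← bijOn_positiveSigns_separationGaussoid.image_eq,
      Set.ncard_image_of_injective _ positiveSigns_separationGaussoid_injective, Set.ncard_univ]
  · intro φ hφ
    obtain ⟨Γ, rfl⟩ := hφ.exists_eq_positiveSigns
    obtain ⟨Q, hQ⟩ := graphMMatrices_nonempty Γ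
    exact ⟨_, ((realizationSpaceHomeomorph Γ).symm ⟨Q, hQ⟩).2⟩
  · intro Γ
    have e : Γ.edgeSet ⊕ Fin n ≃ Fin (Γ.edgeSet.ncard + n) :=
      ((Finite.equivFin Γ.edgeSet).sumCongr (Equiv.refl _)).trans finSumFinEquiv
    obtain ⟨h⟩ := nonempty_graphMMatrices_homeomorph_ball e hn
    exact ⟨(realizationSpaceHomeomorph Γ).trans h⟩
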